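/- Let $p$ be a prime, let $X$ be a set with $p$ elements, and let $\sigma$ be a cyclic permutation of $X$ of order $p$. Let $T_p$ be the rooted $p$-regular tree whose vertices are the finite words over $X$, whose root is the empty word, and in which two words are adjacent when one is obtained from the other by adjoining one letter on the right; its $n$-th level is $X^n$. Let $\operatorname{Aut}(T_p)$ be the group of automorphisms of this rooted tree. For $g\in\operatorname{Aut}(T_p)$ and a word $v$, the section $g|_v\in\operatorname{Aut}(T_p)$ is defined by $g(vw)=g(v)\,g|_v(w)$ for all words $w$. The Sylow pro-$p$ subgroup $\operatorname{Aut}_p(T_p)$ consists of all $g$ such that, for every word $v$, $g|_v$ acts on the first level $X$ as a power of $\sigma$. For $K\le\operatorname{Aut}(T_p)$ let $X\star K$ be the group of all $g$ that fix every vertex of the first level and satisfy $g|_x\in K$ for all $x\in X$. Let $\Gamma\le\operatorname{Aut}(T_p)$ be a subgroup such that: 1. $\Gamma$ is finitely generated; 2. $\Gamma$ is self-similar: $g|_v\in\Gamma$ for all $g\in\Gamma$ and all words $v$; 3. $\Gamma$ is regular branch: $\Gamma$ acts transitively on every level of $T_p$, and there is a finite-index subgroup $K\le\Gamma$ that contains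 $X\star K$ as a subgroup of finite index; 4. $\Gamma\le\operatorname{Aut}_p(T_p)$; 5. $\Gamma$ has the rigid congruence subgroup property: for every $n\ge 0$ there is an $m\ge 0$ such that every element of $\Gamma$ fixing all vertices of level $m$ lies in the subgroup generated by the groups $\operatorname{rist}_\Gamma(v)$, $v\in X^n$, where $\operatorname{rist}_\Gamma(v)$ is the group of all $g\in\Gamma$ that fix every word not having $v$ as a prefix. Then for every integer $k\ge 1$, $$\bigl|\{\Delta\le\operatorname{Aut}(T_p) : [\Gamma:\Gamma\cap\Delta]\,[\Delta:\Gamma\cap\Delta]=p^k\}\bigr|=\aleph_0 .$$ -/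

import Mathlib

namespace RootedTree

universe u

variable {X : Type u}

/-- The rooted tree `T_X`: its vertices are the finite words over `X`, and two words are joined by
an edge when one is obtained from the other by adjoining a letter on the right. The root is `[]`,
and the `n`-th level is the set of words of length `n`. -/
def treeGraph (X : Type u) : SimpleGraph (List X) where
  Adj u v := (∃ x, v = u ++ [x]) ∨ (∃ x, u = v ++ [x])
  symm := ⟨fun _ _ h => h.symm⟩
  loopless := ⟨fun u h => by
    rcases h with ⟨x, hx⟩ | ⟨x, hx⟩ <;> simpa using congrArg List.length hx⟩

/-- The automorphisms of the graph `T_X` that fix the root, as a group under composition. -/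
def rootFixing (X : Type u) : Subgroup (treeGraph X ≃g treeGraph X) where
  carrier := {g | g [] = []}
  one_mem' := rfl
  mul_mem' {a b} ha hb := by
    change a (b []) = []
    rw [show b [] = [] from hb]
    exact ha
  inv_mem' {a} ha := by
    change a.symm [] = []
    rw [RelIso.symm_apply_eq]
    exact (show a [] = [] from ha).symm

/-- `Aut(T_X)`, the group of automorphisms of the rooted tree `T_X`; the image of a vertex `v`
under `g` is `g.1 v`. -/
abbrev TreeAut (X : Type u) : Type u := rootFixing X

lemma map_nil (g : TreeAut X) : g.1 [] = [] := g.2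

lemma mul_apply (g h : TreeAut X) (v : List X) : (g * h).1 v = g.1 (h.1 v) := rfl

lemma one_apply (v : List X) : (1 : TreeAut X).1 v = v := rfl

lemma inv_apply_self (g : TreeAut X) (v : List X) : (g⁻¹).1 (g.1 v) = v :=
  g.1.symm_apply_apply v

lemma apply_inv_self (g : TreeAut X) (v : List X) : g.1 ((g⁻¹).1 v) = v :=
  g.1.apply_symm_apply v

lemma ext_apply {g h : TreeAut X} (H : ∀ v, g.1 v = h.1 v) : g = h :=
  Subtype.ext (RelIso.ext H)

/-- A rooted tree automorphism maps children of `v` to children of `g v`. -/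
lemma map_child (g : TreeAut X) (v : List X) (x : X) : ∃ y, g.1 (v ++ [x]) = g.1 v ++ [y] := by
  induction v using List.reverseRecOn generalizing x with
  | nil =>
    have h : (treeGraph X).Adj (g.1 []) (g.1 ([] ++ [x])) := g.1.map_rel_iff.2 (Or.inl ⟨x, rfl⟩)
    rcases h with h | ⟨y, hy⟩
    · exact h
    · rw [map_nil] at hy
      simp at hy
  | append_singleton v z ih =>
    have h : (treeGraph X).Adj (g.1 (v ++ [z])) (g.1 (v ++ [z] ++ [x])) :=
      g.1.map_rel_iff.2 (Or.inl ⟨x, rfl⟩)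
    rcases h with h | ⟨y, hy⟩
    · exact h
    · obtain ⟨w, hw⟩ := ih z
      rw [hw] at hy
      have h2 := g.1.injective (List.append_inj_left' hy rfl)
      simpa using congrArg List.length h2

lemma map_append (g : TreeAut X) (v w : List X) :
    ∃ w', w'.length = w.length ∧ g.1 (v ++ w) = g.1 v ++ w' := by
  induction w using List.reverseRecOn with
  | nil => exact ⟨[], rfl, by simp⟩
  | append_singleton w x ih =>
    obtain ⟨w', hl, hw⟩ := ih
    obtain ⟨y, hy⟩ := map_child g (v ++ w) x
    exact ⟨w' ++ [y], by simp [hl], by rw [← List.append_assoc, hy, hw, List.append_assoc]⟩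

lemma length_map (g : TreeAut X) (v : List X) : (g.1 v).length = v.length := by
  obtain ⟨w, hl, hw⟩ := map_append g [] v
  simpa [map_nil, hl] using congrArg List.length hw

/-- The word `w'` with `g (v w) = (g v) w'`. -/
def sectionFun (g : TreeAut X) (v w : List X) : List X := (g.1 (v ++ w)).drop v.length

lemma apply_append (g : TreeAut X) (v w : List X) :
    g.1 (v ++ w) = g.1 v ++ sectionFun g v w := by
  obtain ⟨w', _, hw⟩ := map_append g v w
  rw [sectionFun, hw, ← length_map g v, List.drop_left]

lemma sectionFun_leftInverse (g : TreeAut X) (v w : List X) :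
    sectionFun g⁻¹ (g.1 v) (sectionFun g v w) = w := by
  rw [sectionFun, ← apply_append, inv_apply_self, length_map, List.drop_left]

lemma sectionFun_rightInverse (g : TreeAut X) (v w : List X) :
    sectionFun g v (sectionFun g⁻¹ (g.1 v) w) = w := by
  have h := sectionFun_leftInverse g⁻¹ (g.1 v) w
  rwa [inv_inv, inv_apply_self] at h

lemma sectionFun_adj (g : TreeAut X) (v a b : List X) (h : (treeGraph X).Adj a b) :
    (treeGraph X).Adj (sectionFun g v a) (sectionFun g v b) := by
  have key : ∀ (a : List X) (x : X), ∃ y, sectionFun g v (a ++ [x]) = sectionFun g v a ++ [y] := by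
    intro a x
    obtain ⟨y, hy⟩ := map_child g (v ++ a) x
    rw [List.append_assoc, apply_append, apply_append, List.append_assoc] at hy
    exact ⟨y, List.append_cancel_left hy⟩
  rcases h with ⟨x, rfl⟩ | ⟨x, rfl⟩
  · exact Or.inl (key a x)
  · exact Or.inr (key b x)

/-- The section `g|_v`, the automorphism of `T_X` determined by `g (v w) = (g v) (g|_v w)`
for all words `w`. -/
def sect (g : TreeAut X) (v : List X) : TreeAut X :=
  ⟨{ toFun := sectionFun g v
     invFun := sectionFun g⁻¹ (g.1 v)
     left_inv := sectionFun_leftInverse g v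
     right_inv := sectionFun_rightInverse g v
     map_rel_iff' := by
      intro a b
      refine ⟨fun h => ?_, sectionFun_adj g v a b⟩
      have h2 := sectionFun_adj g⁻¹ (g.1 v) _ _ h
      change (treeGraph X).Adj (sectionFun g⁻¹ (g.1 v) (sectionFun g v a))
        (sectionFun g⁻¹ (g.1 v) (sectionFun g v b)) at h2
      rwa [sectionFun_leftInverse, sectionFun_leftInverse] at h2 },
   by
    change sectionFun g v [] = []
    simp [sectionFun, ← length_map g v]⟩

lemma sect_spec (g : TreeAut X) (v w : List X) : g.1 (v ++ w) = g.1 v ++ (sect g v).1 w :=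
  apply_append g v w

lemma sect_eq_of_forall {g h : TreeAut X} {v : List X}
    (H : ∀ w, g.1 (v ++ w) = g.1 v ++ h.1 w) : sect g v = h :=
  ext_apply fun w => List.append_cancel_left ((sect_spec g v w).symm.trans (H w))

lemma sect_one (v : List X) : sect (1 : TreeAut X) v = 1 :=
  sect_eq_of_forall fun _ => rfl

lemma sect_mul (g h : TreeAut X) (v : List X) :
    sect (g * h) v = sect g (h.1 v) * sect h v :=
  sect_eq_of_forall fun w => by
    rw [mul_apply, sect_spec h, sect_spec g, mul_apply, mul_apply]

lemma sect_inv (g : TreeAut X) (v : List X) : sect g⁻¹ (g.1 v) = (sect g v)⁻¹ := by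
  rw [eq_inv_iff_mul_eq_one, ← sect_mul, inv_mul_cancel, sect_one]

/-- `X ⋆ H`: the automorphisms that fix the first level pointwise and whose sections at the
vertices of the first level all lie in `H`. -/
def star (H : Subgroup (TreeAut X)) : Subgroup (TreeAut X) where
  carrier := {g | ∀ x : X, g.1 [x] = [x] ∧ sect g [x] ∈ H}
  one_mem' x := ⟨rfl, by rw [sect_one]; exact H.one_mem⟩
  mul_mem' {a b} ha hb x := by
    refine ⟨by rw [mul_apply, (hb x).1, (ha x).1], ?_⟩
    rw [sect_mul, (hb x).1]
    exact H.mul_mem (ha x).2 (hb x).2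
  inv_mem' {a} ha x := by
    have h1 : (a⁻¹).1 [x] = [x] := by
      conv_lhs => rw [← (ha x).1]
      exact inv_apply_self a [x]
    refine ⟨h1, ?_⟩
    have h2 := sect_inv a [x]
    rw [(ha x).1] at h2
    rw [h2]
    exact H.inv_mem (ha x).2

/-- The `n`-th level stabilizer of `G`. -/
def levelStabilizer (G : Subgroup (TreeAut X)) (n : ℕ) : Subgroup (TreeAut X) where
  carrier := {g | g ∈ G ∧ ∀ v : List X, v.length = n → g.1 v = v}
  one_mem' := ⟨G.one_mem, fun _ _ => rfl⟩
  mul_mem' {a b} ha hb :=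
    ⟨G.mul_mem ha.1 hb.1, fun v hv => by rw [mul_apply, hb.2 v hv, ha.2 v hv]⟩
  inv_mem' {a} ha := ⟨G.inv_mem ha.1, fun v hv => by
    conv_lhs => rw [← ha.2 v hv]
    exact inv_apply_self a v⟩

/-- The rigid stabilizer in `G` of the vertex `v`: the elements of `G` that fix every vertex
outside the subtree `v T_X` of words with prefix `v`. -/
def rigidStabilizer (G : Subgroup (TreeAut X)) (v : List X) : Subgroup (TreeAut X) where
  carrier := {g | g ∈ G ∧ ∀ w : List X, ¬ v <+: w → g.1 w = w}
  one_mem' := ⟨G.one_mem, fun _ _ => rfl⟩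
  mul_mem' {a b} ha hb :=
    ⟨G.mul_mem ha.1 hb.1, fun w hw => by rw [mul_apply, hb.2 w hw, ha.2 w hw]⟩
  inv_mem' {a} ha := ⟨G.inv_mem ha.1, fun w hw => by
    conv_lhs => rw [← ha.2 w hw]
    exact inv_apply_self a w⟩

/-- The `n`-th level rigid stabilizer of `G`: the subgroup generated by the rigid stabilizers of
the vertices of level `n`. -/
def levelRigidStabilizer (G : Subgroup (TreeAut X)) (n : ℕ) : Subgroup (TreeAut X) :=
  ⨆ v ∈ {v : List X | v.length = n}, rigidStabilizer G v

/-- `G` is self-similar: it contains all sections of its elements. -/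
def IsSelfSimilar (G : Subgroup (TreeAut X)) : Prop :=
  ∀ g ∈ G, ∀ v : List X, sect g v ∈ G

/-- `G` acts transitively on each level. -/
def IsLevelTransitive (G : Subgroup (TreeAut X)) : Prop :=
  ∀ v w : List X, v.length = w.length → ∃ g ∈ G, g.1 v = w

/-- `K` is a branching subgroup for `G`: it is a finite-index subgroup of `G` that contains
`X ⋆ K` with finite index. -/
def IsBranchingSubgroup (K G : Subgroup (TreeAut X)) : Prop :=
  K ≤ G ∧ K.IsFiniteRelIndex G ∧ star K ≤ K ∧ (star K).IsFiniteRelIndex K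

/-- `G` is regular branch. -/
def IsRegularBranch (G : Subgroup (TreeAut X)) : Prop :=
  IsLevelTransitive G ∧ ∃ K : Subgroup (TreeAut X), IsBranchingSubgroup K G

/-- The rigid congruence subgroup property: every level rigid stabilizer of `G` contains a level
stabilizer of `G`. -/
def HasRigidCSP (G : Subgroup (TreeAut X)) : Prop :=
  ∀ n : ℕ, ∃ m : ℕ, levelStabilizer G m ≤ levelRigidStabilizer G n

/-- For a permutation `σ` of `X`, the automorphisms of `T_X` all of whose sections act on the first
level as a power of `σ`. When `σ` is a `p`-cycle on a set `X` with `p` elements, `p` prime, this is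
the Sylow pro-`p` subgroup `Aut_p(T_p)`. -/
def sylowProP (σ : Equiv.Perm X) : Subgroup (TreeAut X) where
  carrier := {g | ∀ v : List X, ∃ i : ℤ, ∀ x : X, (sect g v).1 [x] = [(σ ^ i) x]}
  one_mem' v := ⟨0, fun x => by rw [sect_one]; simp⟩
  mul_mem' {a b} ha hb v := by
    obtain ⟨j, hj⟩ := hb v
    obtain ⟨i, hi⟩ := ha (b.1 v)
    exact ⟨i + j, fun x => by rw [sect_mul, mul_apply, hj, hi, zpow_add, Equiv.Perm.mul_apply]⟩
  inv_mem' {a} ha v := by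
    obtain ⟨i, hi⟩ := ha ((a⁻¹).1 v)
    refine ⟨-i, fun x => ?_⟩
    have h := sect_inv a ((a⁻¹).1 v)
    rw [apply_inv_self] at h
    have h2 := hi ((σ ^ (-i)) x)
    rw [← Equiv.Perm.mul_apply, ← zpow_add, add_neg_cancel, zpow_zero, Equiv.Perm.one_apply] at h2
    rw [h, ← h2, inv_apply_self]

end RootedTree

/-- The commensurability index `[H : H ∩ K] [K : H ∩ K]`, with value `0` exactly when it is
infinite. -/
noncomputable def commensurabilityIndex {G : Type*} [Group G] (H K : Subgroup G) : ℕ :=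
  (H ⊓ K).relIndex H * (H ⊓ K).relIndex K

/-- The commensurability growth function: for `n ≥ 1`, the cardinality of the set of subgroups
`Δ` of `G` with `[Γ : Γ ∩ Δ] [Δ : Γ ∩ Δ] = n`. -/
noncomputable def commensurabilityGrowth {G : Type*} [Group G] (Γ : Subgroup G) (n : ℕ) :
    Cardinal :=
  Cardinal.mk {Δ : Subgroup G // commensurabilityIndex Γ Δ = n}

/-!
Countability is a statement about the commensurator of `Γ`. Finite-index subgroups of a branch
group have trivial centralizer in `Aut(T_p)` (`RootedTree.eq_one_of_commute`), so an element of the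
commensurator is determined by how it conjugates finitely many elements of `Γ`. The commensurator
is therefore countable, and every subgroup commensurable with `Γ` is one of its finitely generated
subgroups (`Subgroup.countable_commensurable`).

For infinitude, overgroups of `Γ` of index `p ^ k` are found inside `Γ Lₙ`, where
`Lₙ = X ⋆ ⋯ ⋆ X ⋆ Γ` (`n` times) consists of the automorphisms fixing level `n` with all sections
there in `Γ`; it is normalized by `Γ`. Three facts are used.

* Elements of `Γ` that fix a suitable level `s` may be grafted at any vertex without leaving `Γ`
  (`RootedTree.exists_levelStabilizer_le_graftCore`). The elements of `Γ` whose graft at `v` is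
  again in `Γ` form a subgroup `R_v` with `R_{uw} ≤ R_w`. Its index depends only on the level of
  `v` and is bounded because `Γ` is regular branch, so `R_{uw} = R_w` once `w` is long enough, and
  the rigid congruence subgroup property puts a level stabilizer into all these groups. It follows
  that the elements of `Γ Lₙ` fixing level `n + s` lie in `Γ`. So `Γ Lₙ` and `Γ` differ only by
  their finite images on level `n + s`, which are `p`-groups, and between them there are overgroups
  of `Γ` of every index `p ^ k` not exceeding `[Γ Lₙ : Γ]`.
* `X ⋆ Γ` is not contained in `Γ` (`RootedTree.not_star_le`): otherwise
  `φ ↦ (g ↦ ∏ₓ φ(g|ₓ))` would be an injective, non-surjective map from the finite set of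
  homomorphisms `Γ → ⟨σ⟩` to itself. Hence `[Γ Lₙ : Γ]` grows without bound
  (`RootedTree.exists_separated_family`).
* A proper overgroup of `Γ` inside `Γ Lₙ` contains an element outside `Γ` fixing level `n`, but none
  fixing level `n + s`; so the overgroups obtained for levels more than `s` apart are distinct.
-/

namespace RootedTree

variable {X : Type*}

/-! ### Sections, grafts and level stabilizers -/

lemma sect_sect (g : TreeAut X) (v w : List X) : sect (sect g v) w = sect g (v ++ w) := by
  symm
  refine sect_eq_of_forall fun u => ?_
  rw [List.append_assoc, sect_spec g v (w ++ u), sect_spec g v w, sect_spec (sect g v) w u,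
    List.append_assoc]

lemma sect_nil (g : TreeAut X) : sect g [] = g :=
  sect_eq_of_forall fun w => by rw [map_nil]; rfl

/-- The underlying map on words of `node f`: it leaves the first letter unchanged and applies
`f y` to what follows a first letter `y`. -/
def nodeFun (f : X → TreeAut X) : List X → List X
  | [] => []
  | y :: w => y :: (f y).1 w

lemma nodeFun_nodeFun (f g : X → TreeAut X) (v : List X) :
    nodeFun f (nodeFun g v) = nodeFun (f * g) v := by
  cases v <;> rfl

lemma nodeFun_one (v : List X) : nodeFun (1 : X → TreeAut X) v = v := by
  cases v <;> rfl

lemma nodeFun_adj (f : X → TreeAut X) {a b : List X} (h : (treeGraph X).Adj a b) :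
    (treeGraph X).Adj (nodeFun f a) (nodeFun f b) := by
  have key : ∀ (a : List X) (x : X), ∃ y, nodeFun f (a ++ [x]) = nodeFun f a ++ [y] := by
    intro a x
    cases a with
    | nil => exact ⟨x, by simp [nodeFun, map_nil]⟩
    | cons z w =>
      obtain ⟨y, hy⟩ := map_child (f z) w x
      exact ⟨y, by simp [nodeFun, hy]⟩
  rcases h with ⟨x, rfl⟩ | ⟨x, rfl⟩
  · exact Or.inl (key a x)
  · exact Or.inr (key b x)

/-- The automorphism that fixes the first level and has prescribed sections there, as a
homomorphism in the tuple of sections. -/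
def node : (X → TreeAut X) →* TreeAut X where
  toFun f :=
    ⟨{ toFun := nodeFun f
       invFun := nodeFun f⁻¹
       left_inv := fun v => by rw [nodeFun_nodeFun, inv_mul_cancel, nodeFun_one]
       right_inv := fun v => by rw [nodeFun_nodeFun, mul_inv_cancel, nodeFun_one]
       map_rel_iff' := by
        intro a b
        refine ⟨fun h => ?_, nodeFun_adj f⟩
        have h2 := nodeFun_adj f⁻¹ h
        change (treeGraph X).Adj (nodeFun f⁻¹ (nodeFun f a)) (nodeFun f⁻¹ (nodeFun f b)) at h2
        rwa [nodeFun_nodeFun, nodeFun_nodeFun, inv_mul_cancel, nodeFun_one, nodeFun_one] at h2 },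
     rfl⟩
  map_one' := ext_apply nodeFun_one
  map_mul' f g := ext_apply fun v => (nodeFun_nodeFun f g v).symm

lemma node_apply_cons (f : X → TreeAut X) (y : X) (w : List X) :
    (node f).1 (y :: w) = y :: (f y).1 w := rfl

lemma sect_node (f : X → TreeAut X) (x : X) : sect (node f) [x] = f x :=
  sect_eq_of_forall fun w => by
    rw [List.singleton_append, node_apply_cons, node_apply_cons, map_nil]; rfl

lemma node_mem_star {H : Subgroup (TreeAut X)} {f : X → TreeAut X} (hf : ∀ x, f x ∈ H) :
    node f ∈ star H :=
  fun x => ⟨by rw [node_apply_cons, map_nil], by rw [sect_node]; exact hf x⟩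

lemma node_sect {H : Subgroup (TreeAut X)} {g : TreeAut X} (hg : g ∈ star H) :
    node (fun x => sect g [x]) = g :=
  ext_apply fun v => by
    cases v with
    | nil => rw [map_nil, map_nil]
    | cons x w =>
      rw [node_apply_cons, ← List.singleton_append (l := w), sect_spec g, (hg x).1,
        List.singleton_append]

lemma star_mono {H K : Subgroup (TreeAut X)} (h : H ≤ K) : star H ≤ star K :=
  fun _ hg x => ⟨(hg x).1, h (hg x).2⟩

lemma iterate_star_mono {H K : Subgroup (TreeAut X)} (h : H ≤ K) (n : ℕ) :
    star^[n] H ≤ star^[n] K := by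
  induction n with
  | zero => exact h
  | succ n ih =>
    rw [Function.iterate_succ_apply', Function.iterate_succ_apply']
    exact star_mono ih

lemma iterate_star_le {H : Subgroup (TreeAut X)} (h : star H ≤ H) (n : ℕ) : star^[n] H ≤ H := by
  induction n with
  | zero => exact le_rfl
  | succ n ih =>
    rw [Function.iterate_succ_apply']
    exact (star_mono ih).trans h

open Classical in
/-- The automorphism acting as `g` on the subtree of words with prefix `v` and fixing every other
word, as a homomorphism in `g`. -/
noncomputable def graft : List X → TreeAut X →* TreeAut X
  | [] => MonoidHom.id _
  | x :: v => (node.comp (MonoidHom.mulSingle (fun _ : X => TreeAut X) x)).comp (graft v)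

open Classical in
lemma graft_cons (x : X) (v : List X) (g : TreeAut X) :
    graft (x :: v) g = node (Pi.mulSingle x (graft v g)) := rfl

lemma graft_nil (g : TreeAut X) : graft [] g = g := rfl

lemma graft_append (v w : List X) (g : TreeAut X) : graft (v ++ w) g = graft v (graft w g) := by
  induction v with
  | nil => rfl
  | cons x v ih => rw [List.cons_append, graft_cons, graft_cons, ih]

lemma graft_apply_append (v w : List X) (g : TreeAut X) :
    (graft v g).1 (v ++ w) = v ++ g.1 w := by
  classical
  induction v with
  | nil => rfl
  | cons x v ih =>
    rw [graft_cons, List.cons_append, node_apply_cons, Pi.mulSingle_eq_same, ih, List.cons_append]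

lemma graft_apply_of_not_prefix {v u : List X} (h : ¬ v <+: u) (g : TreeAut X) :
    (graft v g).1 u = u := by
  classical
  induction v generalizing u with
  | nil => exact absurd List.nil_prefix h
  | cons x v ih =>
    cases u with
    | nil => exact map_nil _
    | cons y u =>
      rw [graft_cons, node_apply_cons]
      by_cases hxy : y = x
      · subst hxy
        rw [Pi.mulSingle_eq_same, ih fun h' => h (List.cons_prefix_cons.2 ⟨rfl, h'⟩)]
      · rw [Pi.mulSingle_eq_of_ne hxy, one_apply]

lemma graft_apply_self (v : List X) (g : TreeAut X) : (graft v g).1 v = v := by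
  simpa [map_nil] using graft_apply_append v [] g

lemma sect_graft (v : List X) (g : TreeAut X) : sect (graft v g) v = g :=
  sect_eq_of_forall fun w => by rw [graft_apply_append, graft_apply_self]

lemma graft_mem_iterate_star {H : Subgroup (TreeAut X)} {g : TreeAut X} (hg : g ∈ H)
    (v : List X) : graft v g ∈ star^[v.length] H := by
  classical
  induction v with
  | nil => exact hg
  | cons x v ih =>
    rw [graft_cons, List.length_cons, Function.iterate_succ_apply']
    refine node_mem_star fun y => ?_
    by_cases hxy : y = x
    · subst hxy
      rwa [Pi.mulSingle_eq_same]
    · rw [Pi.mulSingle_eq_of_ne hxy]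
      exact one_mem _

lemma conj_graft (γ g : TreeAut X) (v : List X) :
    γ * graft v g * γ⁻¹ = graft (γ.1 v) (sect γ v * g * (sect γ v)⁻¹) := by
  rw [mul_inv_eq_iff_eq_mul]
  refine ext_apply fun u => ?_
  rw [mul_apply, mul_apply]
  by_cases h : v <+: u
  · obtain ⟨t, rfl⟩ := h
    rw [graft_apply_append, sect_spec γ v t, graft_apply_append, sect_spec, ← mul_apply,
      ← mul_apply, inv_mul_cancel_right]
  · rw [graft_apply_of_not_prefix h, graft_apply_of_not_prefix]
    rintro ⟨t, ht⟩
    refine h ⟨(sect γ v)⁻¹.1 t, γ.1.injective ?_⟩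
    rw [← ht]
    change γ.1 (v ++ _) = _
    rw [sect_spec, apply_inv_self]

/-- An element supported on the subtree at `v` is the graft of its section at `v`. -/
lemma graft_sect_of_mem_rigidStabilizer {G : Subgroup (TreeAut X)} {v : List X} {g : TreeAut X}
    (hg : g ∈ rigidStabilizer G v) : graft v (sect g v) = g := by
  have hv : g.1 v = v := by
    by_contra hne
    have h1 : ¬ v <+: g.1 v := fun h => hne (h.eq_of_length (length_map g v).symm).symm
    exact hne (g.1.injective (hg.2 _ h1))
  refine ext_apply fun u => ?_
  by_cases h : v <+: u
  · obtain ⟨t, rfl⟩ := h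
    rw [graft_apply_append, sect_spec, hv]
  · rw [graft_apply_of_not_prefix h, hg.2 u h]

/-- `X ⋆ H` is generated by its elements supported below a single letter. -/
lemma star_le_of_graft_mem [Finite X] {H N : Subgroup (TreeAut X)}
    (h : ∀ (x : X), ∀ g ∈ H, graft [x] g ∈ N) : star H ≤ N := by
  classical
  intro g hg
  rw [← node_sect hg]
  change (fun x => sect g [x]) ∈ N.comap node
  refine Subgroup.pi_mem_of_mulSingle_mem _ fun x => ?_
  have := h x _ (hg x).2
  rwa [graft_cons, graft_nil] at this

/-- Fixing a level pointwise implies fixing every lower-numbered level pointwise. -/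
lemma levelStabilizer_anti (G : Subgroup (TreeAut X)) {m n : ℕ} (hmn : m ≤ n) :
    levelStabilizer G n ≤ levelStabilizer G m := by
  refine fun g hg => ⟨hg.1, fun v hv => ?_⟩
  cases v with
  | nil => exact map_nil g
  | cons x v =>
    have h := hg.2 (x :: v ++ List.replicate (n - m) x)
      (by rw [List.length_append, List.length_replicate, hv]; omega)
    rw [sect_spec] at h
    exact List.append_inj_left h (length_map _ _)

lemma sect_mem_levelStabilizer_top {g : TreeAut X} {m n : ℕ}
    (hg : g ∈ levelStabilizer (⊤ : Subgroup (TreeAut X)) (m + n)) {v : List X}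
    (hv : v.length = m) : sect g v ∈ levelStabilizer (⊤ : Subgroup (TreeAut X)) n := by
  refine ⟨trivial, fun w hw => ?_⟩
  have h := hg.2 (v ++ w) (by rw [List.length_append, hv, hw])
  rw [sect_spec] at h
  exact List.append_inj_right h (length_map _ _)

lemma star_levelStabilizer_le (H : Subgroup (TreeAut X)) (n : ℕ) :
    star (levelStabilizer H n) ≤ levelStabilizer ⊤ (n + 1) := by
  refine fun g hg => ⟨trivial, fun v hv => ?_⟩
  cases v with
  | nil => exact map_nil g
  | cons x w =>
    rw [← List.singleton_append, sect_spec, (hg x).1, (hg x).2.2 w (by simpa using hv)]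

lemma iterate_star_le_levelStabilizer (H : Subgroup (TreeAut X)) (n : ℕ) :
    star^[n] H ≤ levelStabilizer ⊤ n := by
  induction n with
  | zero => exact fun g _ => ⟨trivial, fun v hv => by rw [List.length_eq_zero_iff.1 hv, map_nil]⟩
  | succ n ih =>
    rw [Function.iterate_succ_apply']
    exact (star_mono ih).trans (star_levelStabilizer_le ⊤ n)

/-- An element of the `n`-fold iterate `X ⋆ ⋯ ⋆ X ⋆ H` that fixes level `n + s` has all its
sections at level `n` in the stabilizer of level `s` in `H`. -/
lemma iterate_star_inf_levelStabilizer_le (H : Subgroup (TreeAut X)) (n s : ℕ) :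
    star^[n] H ⊓ levelStabilizer ⊤ (n + s) ≤ star^[n] (levelStabilizer H s) := by
  induction n with
  | zero =>
    rintro g ⟨h1, h2⟩
    exact ⟨h1, fun v hv => h2.2 v (by omega)⟩
  | succ n ih =>
    rw [Function.iterate_succ_apply', Function.iterate_succ_apply']
    rintro g ⟨h1, h2⟩ x
    refine ⟨(h1 x).1, ih ⟨(h1 x).2, ?_⟩⟩
    rw [show n + 1 + s = 1 + (n + s) by omega] at h2
    exact sect_mem_levelStabilizer_top h2 rfl

/-- In a self-similar group the stabilizer of level `n` lies in the `n`-fold iterate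
`X ⋆ ⋯ ⋆ X ⋆ G`. -/
lemma mem_iterate_star_of_mem_levelStabilizer {G : Subgroup (TreeAut X)} (hG : IsSelfSimilar G)
    {n : ℕ} {g : TreeAut X} (hg : g ∈ G)
    (hn : g ∈ levelStabilizer (⊤ : Subgroup (TreeAut X)) n) : g ∈ star^[n] G := by
  induction n generalizing g with
  | zero => exact hg
  | succ n ih =>
    rw [Function.iterate_succ_apply']
    refine fun x => ⟨(levelStabilizer_anti ⊤ (Nat.le_add_left 1 n) hn).2 [x] rfl,
      ih (hG g hg [x]) ?_⟩
    rw [add_comm] at hn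
    exact sect_mem_levelStabilizer_top hn rfl

/-- A self-similar group normalizes each iterate `X ⋆ ⋯ ⋆ X ⋆ G`. -/
lemma conj_mem_iterate_star {G : Subgroup (TreeAut X)} (hG : IsSelfSimilar G) (n : ℕ)
    {γ g : TreeAut X} (hγ : γ ∈ G) (hg : g ∈ star^[n] G) : γ * g * γ⁻¹ ∈ star^[n] G := by
  induction n generalizing γ g with
  | zero => exact G.mul_mem (G.mul_mem hγ hg) (G.inv_mem hγ)
  | succ n ih =>
    rw [Function.iterate_succ_apply'] at hg ⊢
    intro x
    -- `y` is the letter that `γ` sends to `x`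
    obtain ⟨y, hy⟩ : ∃ y, γ.1 [y] = [x] := by
      obtain ⟨y, hy⟩ := List.length_eq_one_iff.1 (length_map γ⁻¹ [x])
      exact ⟨y, by rw [← hy, apply_inv_self]⟩
    have hy' : (γ⁻¹).1 [x] = [y] := by rw [← hy, inv_apply_self]
    refine ⟨by rw [mul_apply, mul_apply, hy', (hg y).1, hy], ?_⟩
    rw [sect_mul, hy', sect_mul, (hg y).1]
    have h := sect_inv γ [y]
    rw [hy] at h
    rw [h]
    exact ih (hG γ hγ [y]) (hg y).2

/-! ### The largest branching subgroup contains a level stabilizer -/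

lemma graft_mem_of_star_le {K : Subgroup (TreeAut X)} (hK : star K ≤ K) {g : TreeAut X}
    (hg : g ∈ K) (v : List X) : graft v g ∈ K :=
  iterate_star_le hK _ (graft_mem_iterate_star hg v)

/-- The elements all of whose grafts lie in `G`. For finite `X` this is the largest subgroup `M`
of `G` with `X ⋆ M ≤ M`. -/
noncomputable def graftCore (G : Subgroup (TreeAut X)) : Subgroup (TreeAut X) :=
  ⨅ v : List X, G.comap (graft v)

lemma mem_graftCore {G : Subgroup (TreeAut X)} {g : TreeAut X} :
    g ∈ graftCore G ↔ ∀ v, graft v g ∈ G := by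
  simp [graftCore, Subgroup.mem_iInf]

lemma graftCore_le (G : Subgroup (TreeAut X)) : graftCore G ≤ G :=
  fun _ hg => mem_graftCore.1 hg []

lemma star_graftCore_le [Finite X] (G : Subgroup (TreeAut X)) :
    star (graftCore G) ≤ graftCore G :=
  star_le_of_graft_mem fun x g hg => mem_graftCore.2 fun v => by
    rw [← graft_append]
    exact mem_graftCore.1 hg _

lemma comap_graft_le {G : Subgroup (TreeAut X)} (hG : IsSelfSimilar G) (v : List X) :
    G.comap (graft v) ≤ G := fun g hg => by
  rw [← sect_graft v g]
  exact hG _ hg v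

/-- The group of elements whose graft lies in `G` can only shrink when the vertex is prefixed by
another word. -/
lemma comap_graft_append_le {G : Subgroup (TreeAut X)} (hG : IsSelfSimilar G) (u w : List X) :
    G.comap (graft (u ++ w)) ≤ G.comap (graft w) := fun g hg => by
  change graft w g ∈ G
  refine comap_graft_le hG u ?_
  change graft u (graft w g) ∈ G
  rwa [← graft_append]

/-- The index in `G` of the group of elements whose graft at `v` lies in `G` depends only on the
level of `v`: for `γ ∈ G`, the groups at `v` and at `γ v` are conjugate by `γ|_v ∈ G`. -/
lemma relIndex_comap_graft_eq {G : Subgroup (TreeAut X)} (hG : IsSelfSimilar G)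
    (htrans : IsLevelTransitive G) {v w : List X} (hvw : v.length = w.length) :
    (G.comap (graft v)).relIndex G = (G.comap (graft w)).relIndex G := by
  obtain ⟨γ, hγ, rfl⟩ := htrans v w hvw
  have hδ : sect γ v ∈ G := hG γ hγ v
  have h1 : G.comap (graft v) =
      (G.comap (graft (γ.1 v))).comap (MulAut.conj (sect γ v)).toMonoidHom := by
    ext g
    change graft v g ∈ G ↔ graft (γ.1 v) (sect γ v * g * (sect γ v)⁻¹) ∈ G
    rw [← conj_graft, Subgroup.mul_mem_cancel_right _ (G.inv_mem hγ),
      Subgroup.mul_mem_cancel_left _ hγ]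
  have h2 : G.map (MulAut.conj (sect γ v)).toMonoidHom = G := by
    ext g
    constructor
    · rintro ⟨g, hg, rfl⟩
      exact G.mul_mem (G.mul_mem hδ hg) (G.inv_mem hδ)
    · intro hg
      refine ⟨(sect γ v)⁻¹ * g * sect γ v, G.mul_mem (G.mul_mem (G.inv_mem hδ) hg) hδ, ?_⟩
      change sect γ v * ((sect γ v)⁻¹ * g * sect γ v) * (sect γ v)⁻¹ = g
      group
  rw [h1, Subgroup.relIndex_comap, h2]

/-- The rigid congruence subgroup property, for a self-similar regular branch group `G`, bounds
uniformly the depth from which on elements of `G` may be grafted at arbitrary vertices. -/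
lemma exists_levelStabilizer_le_graftCore {G : Subgroup (TreeAut X)} (hG : IsSelfSimilar G)
    (hbranch : IsRegularBranch G) (hrcsp : HasRigidCSP G) :
    ∃ s, levelStabilizer G s ≤ graftCore G := by
  obtain ⟨htrans, K, hKG, hKfin, hKstar, -⟩ := hbranch
  let f : List X → ℕ := fun v => (G.comap (graft v)).relIndex G
  have hf0 : ∀ v, f v ∣ K.relIndex G := fun v =>
    Subgroup.relIndex_dvd_of_le_left G fun g hg => hKG (graft_mem_of_star_le hKstar hg v)
  have hK0 : K.relIndex G ≠ 0 := hKfin.relIndex_ne_zero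
  have hf1 : ∀ v, f v ≠ 0 := fun v h => hK0 (Nat.eq_zero_of_zero_dvd (h ▸ hf0 v))
  -- the index is bounded, hence attains its maximum at some word `w₀`
  obtain ⟨w₀, hw₀⟩ : ∃ w₀, ∀ v, f v ≤ f w₀ := by
    have hbdd : BddAbove (Set.range f) :=
      ⟨K.relIndex G, by
        rintro _ ⟨v, rfl⟩
        exact Nat.le_of_dvd (Nat.pos_of_ne_zero hK0) (hf0 v)⟩
    obtain ⟨w₀, hw₀⟩ := Nat.sSup_mem (Set.range_nonempty f) hbdd
    exact ⟨w₀, fun v => hw₀ ▸ le_csSup hbdd ⟨v, rfl⟩⟩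
  -- from the level of `w₀` on, prefixing a word imposes no further condition
  have key : ∀ u w : List X, w.length = w₀.length →
      G.comap (graft w) ≤ G.comap (graft (u ++ w)) := by
    intro u w hw
    have h1 : f w = f w₀ := relIndex_comap_graft_eq hG htrans hw
    have h2 := Subgroup.relIndex_mul_relIndex _ _ _ (comap_graft_append_le hG u w)
      (comap_graft_le hG w)
    change _ * f w = f (u ++ w) at h2
    have h3 : f (u ++ w) ≤ f w := h1 ▸ hw₀ _
    rw [← Subgroup.relIndex_eq_one]
    refine le_antisymm ?_ (Nat.pos_of_ne_zero fun h0 => hf1 (u ++ w) (by rw [← h2, h0, zero_mul]))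
    exact Nat.le_of_mul_le_mul_right (by rw [h2, one_mul]; exact h3)
      (Nat.pos_of_ne_zero (hf1 w))
  obtain ⟨s, hs⟩ := hrcsp w₀.length
  refine ⟨s, hs.trans (iSup₂_le fun w hw g hg => mem_graftCore.2 fun u => ?_)⟩
  rw [← graft_sect_of_mem_rigidStabilizer hg, ← graft_append]
  refine key u w hw ?_
  change graft w (sect g w) ∈ G
  rw [graft_sect_of_mem_rigidStabilizer hg]
  exact hg.1

/-! ### A finitely generated group does not contain its first-level power -/

lemma finite_monoidHom_of_fg {G A : Type*} [Group G] [Group A] [Finite A]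
    (hG : (⊤ : Subgroup G).FG) : Finite (G →* A) := by
  obtain ⟨S, hS⟩ := hG
  refine Finite.of_injective (fun (φ : G →* A) (s : S) => φ s) fun φ ψ h => ?_
  exact MonoidHom.eq_of_eqOn_dense hS fun s hs => congrFun h ⟨s, hs⟩

/-- The letter `y` with `g [x] = [y]`. -/
def letterMap (g : TreeAut X) (x : X) : X :=
  (g.1 [x]).head (List.ne_nil_of_length_pos (by rw [length_map]; exact Nat.one_pos))

lemma apply_singleton_eq_letterMap (g : TreeAut X) (x : X) : g.1 [x] = [letterMap g x] := by
  obtain ⟨y, hy⟩ := List.length_eq_one_iff.1 (length_map g [x])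
  simp [letterMap, hy]

lemma letterMap_mul (g h : TreeAut X) (x : X) :
    letterMap (g * h) x = letterMap g (letterMap h x) := by
  have := mul_apply g h [x]
  simpa only [apply_singleton_eq_letterMap, List.cons.injEq, and_true] using this

lemma letterMap_one (x : X) : letterMap 1 x = x := rfl

/-- The permutation of the letters induced by a tree automorphism. -/
def levelOneAction : TreeAut X →* Equiv.Perm X where
  toFun g :=
    { toFun := letterMap g
      invFun := letterMap g⁻¹
      left_inv := fun x => by rw [← letterMap_mul, inv_mul_cancel, letterMap_one]
      right_inv := fun x => by rw [← letterMap_mul, mul_inv_cancel, letterMap_one] }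
  map_one' := Equiv.ext letterMap_one
  map_mul' g h := Equiv.ext (letterMap_mul g h)

lemma apply_singleton (g : TreeAut X) (x : X) : g.1 [x] = [levelOneAction g x] :=
  apply_singleton_eq_letterMap g x

lemma levelOneAction_mem_zpowers {σ : Equiv.Perm X} {g : TreeAut X} (hg : g ∈ sylowProP σ) :
    levelOneAction g ∈ Subgroup.zpowers σ := by
  obtain ⟨i, hi⟩ := hg []
  refine ⟨i, Equiv.ext fun x => ?_⟩
  have := hi x
  rw [sect_nil, apply_singleton] at this
  simpa using this.symm

/-- For a homomorphism `φ` to a commutative group, the homomorphism sending `g` to the product of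
the values of `φ` at the sections of `g` on the first level. -/
noncomputable def sectProd [Fintype X] {A : Type*} [CommGroup A] {G : Subgroup (TreeAut X)}
    (hG : IsSelfSimilar G) (φ : G →* A) : G →* A where
  toFun g := ∏ x, φ ⟨sect g.1 [x], hG _ g.2 _⟩
  map_one' := by
    refine Finset.prod_eq_one fun x _ => ?_
    rw [← map_one φ]
    exact congrArg φ (Subtype.ext (sect_one _))
  map_mul' g h := by
    rw [← Equiv.prod_comp (levelOneAction h.1) (fun x => φ ⟨sect g.1 [x], hG _ g.2 _⟩),
      ← Finset.prod_mul_distrib]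
    refine Finset.prod_congr rfl fun x _ => ?_
    rw [← map_mul]
    refine congrArg φ (Subtype.ext ?_)
    change sect (g.1 * h.1) [x] = sect g.1 [levelOneAction h.1 x] * sect h.1 [x]
    rw [sect_mul, apply_singleton]

/-- Suppose `X ⋆ G ≤ G`. Then the operator `sectProd` on the finite set of homomorphisms from `G`
to `⟨σ⟩` is injective, because the elements grafted at one letter recover `φ` from `sectProd φ`;
it is not surjective, because it misses the action on the first level, which is trivial on those
elements. -/
lemma not_star_le [Fintype X] [Nontrivial X] {G : Subgroup (TreeAut X)} (hfg : G.FG)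
    (hG : IsSelfSimilar G) (htrans : IsLevelTransitive G) {σ : Equiv.Perm X}
    (hsylow : G ≤ sylowProP σ) : ¬ star G ≤ G := by
  classical
  intro hstar
  let A := Subgroup.zpowers σ
  let _ : CommGroup A := { (inferInstance : Group A) with mul_comm := mul_comm' }
  have hfin : Finite (G →* A) :=
    finite_monoidHom_of_fg ((Group.fg_iff_subgroup_fg G).2 hfg).out
  obtain ⟨x₀, x₁, hx⟩ := exists_pair_ne X
  let ι : G → G := fun g => ⟨graft [x₀] g.1, graft_mem_of_star_le hstar g.2 _⟩
  have hι : ∀ (φ : G →* A) (g : G), sectProd hG φ (ι g) = φ g := by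
    intro φ g
    change ∏ x, φ ⟨sect (graft [x₀] g.1) [x], _⟩ = _
    rw [Finset.prod_eq_single x₀]
    · exact congrArg φ (Subtype.ext (sect_graft _ _))
    · intro x _ hxx
      rw [← map_one φ]
      refine congrArg φ (Subtype.ext ?_)
      change sect (graft [x₀] g.1) [x] = 1
      rw [graft_cons, sect_node, Pi.mulSingle_eq_of_ne hxx]
    · exact fun h => absurd (Finset.mem_univ _) h
  have hinj : Function.Injective (sectProd hG : (G →* A) → (G →* A)) := by
    intro φ ψ h
    ext1 g
    rw [← hι φ, ← hι ψ, h]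
  let e : G →* A := (levelOneAction.comp G.subtype).codRestrict A
    fun g => levelOneAction_mem_zpowers (hsylow g.2)
  obtain ⟨φ, hφ⟩ := (Finite.injective_iff_surjective.1 hinj) e
  have hφ1 : φ = 1 := by
    ext1 g
    rw [← hι φ, hφ]
    refine Subtype.ext (Equiv.ext fun x => ?_)
    change levelOneAction (graft [x₀] g.1) x = x
    have h : (graft [x₀] g.1).1 [x] = [x] := by
      rw [graft_cons, node_apply_cons, map_nil]
    rw [apply_singleton] at h
    simpa using h
  have he : e = 1 := by
    rw [← hφ, hφ1]
    ext1 g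
    exact Finset.prod_eq_one fun _ _ => rfl
  obtain ⟨g, hg, hgx⟩ := htrans [x₀] [x₁] rfl
  rw [apply_singleton] at hgx
  have he' : e ⟨g, hg⟩ = 1 := by rw [he]; rfl
  have h1 : levelOneAction g = 1 := congrArg Subtype.val he'
  rw [h1] at hgx
  exact hx (by simpa using hgx)

end RootedTree

/-! ### Intermediate subgroups of prescribed prime power index -/

namespace Subgroup

variable {A B : Type*} [Group A] [Group B]

lemma relIndex_map_map_of_inf_ker_le (f : A →* B) {H D : Subgroup A} (hHD : H ≤ D)
    (hker : D ⊓ f.ker ≤ H) : (H.map f).relIndex (D.map f) = H.relIndex D := by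
  rw [← relIndex_comap, ← inf_relIndex_right ((H.map f).comap f), ← inf_relIndex_right H]
  congr 1
  ext x
  constructor
  · rintro ⟨⟨h, hh, hx⟩, hxD⟩
    refine ⟨?_, hxD⟩
    have h1 : h⁻¹ * x ∈ H := hker ⟨D.mul_mem (D.inv_mem (hHD hh)) hxD, f.mem_ker.2 <| by
      rw [map_mul, map_inv, hx, inv_mul_cancel]⟩
    simpa using H.mul_mem hh h1
  · rintro ⟨hx, hxD⟩
    exact ⟨⟨x, hx, rfl⟩, hxD⟩

lemma card_mul_relIndex {H D : Subgroup A} (h : H ≤ D) :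
    Nat.card H * H.relIndex D = Nat.card D := by
  rw [← relIndex_bot_left, ← relIndex_bot_left, relIndex_mul_relIndex _ _ _ bot_le h]

/-- If `G` acts through a finite group `B` as a `p`-group and `Γ ≤ G` contains the kernel of this
action, then `Γ` has overgroups in `G` of every index `p ^ k` up to `[G : Γ]`. -/
lemma exists_relIndex_eq_prime_pow [Finite B] (f : A →* B) {p : ℕ} (hp : p.Prime)
    {Γ G : Subgroup A} (hΓG : Γ ≤ G) (hker : G ⊓ f.ker ≤ Γ) (hG : IsPGroup p (G.map f)) {k : ℕ}
    (hk : p ^ k ≤ Γ.relIndex G) : ∃ D : Subgroup A, Γ ≤ D ∧ D ≤ G ∧ Γ.relIndex D = p ^ k := by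
  have : Fact p.Prime := ⟨hp⟩
  have hmap : Γ.map f ≤ G.map f := map_mono hΓG
  obtain ⟨b, hb⟩ := IsPGroup.iff_card.1 hG
  obtain ⟨a, ha⟩ := IsPGroup.iff_card.1 (hG.to_le hmap)
  have hpos : ∀ n, 0 < p ^ n := fun n => pow_pos hp.pos n
  have hab : a + k ≤ b := by
    have hidx := card_mul_relIndex hmap
    rw [relIndex_map_map_of_inf_ker_le f hΓG hker, ha, hb] at hidx
    have h1 := Nat.mul_le_mul_left (p ^ a) hk
    rw [hidx, ← pow_add] at h1
    exact (Nat.pow_le_pow_iff_right hp.one_lt).1 h1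
  obtain ⟨K, hK, hle⟩ := Sylow.exists_subgroup_card_pow_prime_le p
    (hb.symm ▸ pow_dvd_pow p hab) ((Γ.map f).subgroupOf (G.map f))
    (by rw [← ha, ← card_map_of_injective (G.map f).subtype_injective,
      map_subgroupOf_eq_of_le hmap]) (Nat.le_add_right a k)
  let R := K.map (G.map f).subtype
  have hRG : R ≤ G.map f := map_subtype_le K
  have hRcard : Nat.card R = p ^ (a + k) := by
    rw [← hK, card_map_of_injective (G.map f).subtype_injective]
  have hΓR : Γ.map f ≤ R := by
    rw [← map_subgroupOf_eq_of_le hmap]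
    exact map_mono hle
  have hΓD : Γ ≤ G ⊓ R.comap f := le_inf hΓG (map_le_iff_le_comap.1 hΓR)
  refine ⟨G ⊓ R.comap f, hΓD, inf_le_left, ?_⟩
  have hDR : (G ⊓ R.comap f).map f = R := by
    refine le_antisymm (map_le_iff_le_comap.2 inf_le_right) fun r hr => ?_
    obtain ⟨g, hg, rfl⟩ := hRG hr
    exact ⟨g, ⟨hg, hr⟩, rfl⟩
  rw [← relIndex_map_map_of_inf_ker_le f hΓD ((inf_le_inf_right _ inf_le_left).trans hker), hDR]
  have h2 := card_mul_relIndex hΓR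
  rw [ha, hRcard, pow_add] at h2
  exact Nat.eq_of_mul_eq_mul_left (hpos a) h2

/-- Elements of `D` in pairwise distinct left cosets of `H` bound the index `[D : H]` from
below. -/
lemma card_le_relIndex {ι : Type*} {H D : Subgroup A} (hfin : H.relIndex D ≠ 0) (f : ι → A)
    (hf : ∀ i, f i ∈ D) (hsep : ∀ i j, (f i)⁻¹ * f j ∈ H → i = j) :
    Nat.card ι ≤ H.relIndex D := by
  have : (H.subgroupOf D).FiniteIndex := ⟨hfin⟩
  refine Nat.card_le_card_of_injective
    (fun i => QuotientGroup.mk (s := H.subgroupOf D) (⟨f i, hf i⟩ : D))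
    fun i j hij => hsep i j ?_
  exact (QuotientGroup.eq (s := H.subgroupOf D) (a := ⟨f i, hf i⟩) (b := ⟨f j, hf j⟩)).1 hij

end Subgroup

namespace RootedTree

variable {X : Type*}

/-- The action of tree automorphisms on a level. -/
def levelAction (m : ℕ) : TreeAut X →* Equiv.Perm (List.Vector X m) where
  toFun g :=
    { toFun := fun v => ⟨g.1 v.1, by rw [length_map, v.2]⟩
      invFun := fun v => ⟨(g⁻¹).1 v.1, by rw [length_map, v.2]⟩
      left_inv := fun v => Subtype.ext (inv_apply_self g v.1)
      right_inv := fun v => Subtype.ext (apply_inv_self g v.1) }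
  map_one' := rfl
  map_mul' _ _ := rfl

lemma ker_levelAction (m : ℕ) :
    (levelAction m : TreeAut X →* _).ker = levelStabilizer ⊤ m := by
  ext g
  constructor
  · refine fun h => ⟨trivial, fun v hv => ?_⟩
    exact congrArg Subtype.val (DFunLike.congr_fun h (⟨v, hv⟩ : List.Vector X m))
  · exact fun h => Equiv.ext fun v => Subtype.ext (h.2 v.1 v.2)

lemma sect_mem_sylowProP {σ : Equiv.Perm X} {g : TreeAut X} (hg : g ∈ sylowProP σ)
    (v : List X) : sect g v ∈ sylowProP σ := fun w => by
  rw [sect_sect]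
  exact hg (v ++ w)

lemma star_sylowProP_le (σ : Equiv.Perm X) : star (sylowProP σ) ≤ sylowProP σ := by
  intro g hg v
  cases v with
  | nil => exact ⟨0, fun x => by rw [sect_nil, (hg x).1]; rfl⟩
  | cons x w =>
    rw [← List.singleton_append, ← sect_sect]
    exact (hg x).2 w

/-- Every element of `Aut_p(T_p)` acts on each level with `p`-power order. -/
lemma pow_mem_levelStabilizer {σ : Equiv.Perm X} {p : ℕ} (hσ : σ ^ p = 1) {g : TreeAut X}
    (hg : g ∈ sylowProP σ) (m : ℕ) : g ^ p ^ m ∈ levelStabilizer (⊤ : Subgroup (TreeAut X)) m := by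
  induction m generalizing g with
  | zero => exact ⟨trivial, fun v hv => by rw [List.length_eq_zero_iff.1 hv, map_nil]⟩
  | succ m ih =>
    have hstar : g ^ p ∈ star (sylowProP σ) := by
      intro x
      refine ⟨?_, sect_mem_sylowProP (pow_mem hg p) _⟩
      obtain ⟨i, hi⟩ := levelOneAction_mem_zpowers hg
      have : levelOneAction (g ^ p) = 1 := by
        rw [map_pow, ← hi]
        change (σ ^ i) ^ p = 1
        rw [← zpow_natCast, zpow_comm, zpow_natCast, hσ, one_zpow]
      rw [apply_singleton, this, Equiv.Perm.one_apply]
    rw [pow_succ', pow_mul, ← node_sect hstar, ← map_pow]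
    exact star_levelStabilizer_le ⊤ m (node_mem_star fun x => ih (hstar x).2)

lemma isPGroup_map_levelAction {σ : Equiv.Perm X} {p : ℕ} (hσ : σ ^ p = 1)
    {G : Subgroup (TreeAut X)} (hG : G ≤ sylowProP σ) (m : ℕ) :
    IsPGroup p (G.map (levelAction m)) := by
  rintro ⟨_, g, hg, rfl⟩
  refine ⟨m, Subtype.ext ?_⟩
  change levelAction m g ^ p ^ m = 1
  rw [← map_pow, ← MonoidHom.mem_ker, ker_levelAction]
  exact pow_mem_levelStabilizer hσ (hG hg) m

/-! ### Overgroups that agree with `Γ` deep in the tree -/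

/-- Elements of `Γ (X ⋆ ⋯ ⋆ X ⋆ Γ)` decompose as products, since `Γ` normalizes the second
factor. -/
lemma exists_mul_of_mem_sup_iterate_star {Γ : Subgroup (TreeAut X)} (hself : IsSelfSimilar Γ)
    {n : ℕ} {g : TreeAut X} (hg : g ∈ Γ ⊔ star^[n] Γ) :
    ∃ γ ∈ Γ, ∃ l ∈ star^[n] Γ, γ * l = g := by
  have hnorm : Γ ≤ Subgroup.normalizer (star^[n] Γ : Subgroup (TreeAut X)) := by
    refine fun γ hγ => Subgroup.mem_normalizer_iff.2 fun h =>
      ⟨conj_mem_iterate_star hself n hγ, fun hh => ?_⟩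
    have := conj_mem_iterate_star hself n (Γ.inv_mem hγ) hh
    rwa [show γ⁻¹ * (γ * h * γ⁻¹) * γ⁻¹⁻¹ = h by group] at this
  rw [← SetLike.mem_coe, Subgroup.coe_mul_of_left_le_normalizer_right _ _ hnorm] at hg
  exact Set.mem_mul.1 hg

/-- The overgroup of `Γ` generated by the `n`-fold iterate `X ⋆ ⋯ ⋆ X ⋆ Γ` has no new elements
fixing level `n + s`. -/
lemma sup_iterate_star_inf_levelStabilizer_le [Finite X] {Γ : Subgroup (TreeAut X)}
    (hself : IsSelfSimilar Γ) {s : ℕ} (hs : levelStabilizer Γ s ≤ graftCore Γ) (n : ℕ) :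
    (Γ ⊔ star^[n] Γ) ⊓ levelStabilizer ⊤ (n + s) ≤ Γ := by
  rintro g ⟨hg, hgs⟩
  obtain ⟨γ, hγ, l, hl, rfl⟩ := exists_mul_of_mem_sup_iterate_star hself hg
  have hγn : γ ∈ levelStabilizer (⊤ : Subgroup (TreeAut X)) n := by
    have h1 := levelStabilizer_anti ⊤ (Nat.le_add_right n s) hgs
    exact (Subgroup.mul_mem_cancel_right _ (iterate_star_le_levelStabilizer Γ n hl)).1 h1
  have hgn : γ * l ∈ star^[n] Γ :=
    mul_mem (mem_iterate_star_of_mem_levelStabilizer hself hγ hγn) hl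
  exact graftCore_le Γ (iterate_star_le (star_graftCore_le Γ) n (iterate_star_mono hs n
    (iterate_star_inf_levelStabilizer_le Γ n s ⟨hgn, hgs⟩)))

/-- When `X ⋆ Γ` is not contained in `Γ`, the `n`-fold iterate `X ⋆ ⋯ ⋆ X ⋆ Γ` meets exponentially
many cosets of `Γ`: at each step, the sections at one letter separate as many cosets as before,
and those at another letter double their number. -/
lemma exists_separated_family [Nontrivial X] {Γ : Subgroup (TreeAut X)}
    (hself : IsSelfSimilar Γ) (hstar : ¬ star Γ ≤ Γ) (n : ℕ) :
    ∃ f : (Fin n → Bool) → TreeAut X, (∀ i, f i ∈ star^[n + 1] Γ) ∧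
      ∀ i j, (f i)⁻¹ * f j ∈ Γ → i = j := by
  classical
  obtain ⟨z₀, hz₀, hz₀'⟩ := SetLike.not_le_iff_exists.1 hstar
  obtain ⟨x, y, hxy⟩ := exists_pair_ne X
  induction n with
  | zero => exact ⟨fun _ => 1, fun _ => one_mem _, fun i j _ => Subsingleton.elim i j⟩
  | succ n ih =>
    obtain ⟨f, hf, hsep⟩ := ih
    let v := List.replicate n x
    have hz : graft v z₀ ∈ star^[n + 1] Γ := by
      have := graft_mem_iterate_star hz₀ v
      rwa [List.length_replicate] at this
    have hz' : graft v z₀ ∉ Γ := fun h => hz₀' (sect_graft v z₀ ▸ hself _ h v)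
    let c : Bool → TreeAut X := fun b => bif b then graft v z₀ else 1
    have hc : ∀ b, c b ∈ star^[n + 1] Γ := by
      rintro (_ | _)
      exacts [one_mem _, hz]
    have hcsep : ∀ a b, (c a)⁻¹ * c b ∈ Γ → a = b := by
      rintro (_ | _) (_ | _) h
      · rfl
      · exact absurd (by simpa [c] using h) hz'
      · exact absurd (by simpa [c] using h) hz'
      · rfl
    let F : (Fin (n + 1) → Bool) → X → TreeAut X := fun i =>
      Function.update (fun _ => c (i 0)) x (f (Fin.tail i))
    refine ⟨fun i => node (F i), fun i => ?_, fun i j hij => ?_⟩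
    · rw [Function.iterate_succ_apply']
      refine node_mem_star fun w => ?_
      by_cases hw : w = x
      · subst hw
        simpa [F] using hf _
      · simpa [F, hw] using hc _
    · rw [← map_inv, ← map_mul] at hij
      have hsec : ∀ w, (F i w)⁻¹ * F j w ∈ Γ := fun w => by
        have := hself _ hij [w]
        rwa [sect_node] at this
      have h1 : Fin.tail i = Fin.tail j := hsep _ _ (by simpa [F] using hsec x)
      have h2 : i 0 = j 0 := hcsep _ _ (by simpa [F, hxy.symm] using hsec y)
      rw [← Fin.cons_self_tail i, ← Fin.cons_self_tail j, h1, h2]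

/-- For all sufficiently deep levels `n` there is an overgroup of `Γ` of index `p ^ k` that
contains new elements fixing level `n`, but none fixing level `n + s`. -/
lemma exists_overgroup [Finite X] [Nontrivial X] {p : ℕ} (hp : p.Prime) {σ : Equiv.Perm X}
    (hσ : σ ^ p = 1) {Γ : Subgroup (TreeAut X)} (hself : IsSelfSimilar Γ)
    (hsylow : Γ ≤ sylowProP σ) (hstar : ¬ star Γ ≤ Γ) {s : ℕ}
    (hs : levelStabilizer Γ s ≤ graftCore Γ) {k : ℕ} (hk : 1 ≤ k) {n : ℕ}
    (hn : p ^ k ≤ 2 ^ n) :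
    ∃ D : Subgroup (TreeAut X), Γ ≤ D ∧ Γ.relIndex D = p ^ k ∧
      ¬ D ⊓ levelStabilizer ⊤ (n + 1) ≤ Γ ∧ D ⊓ levelStabilizer ⊤ (n + 1 + s) ≤ Γ := by
  have hfinX : Finite (List.Vector X (n + 1 + s)) := by
    have := Fintype.ofFinite X
    infer_instance
  let G := Γ ⊔ star^[n + 1] Γ
  have hΓG : Γ ≤ G := le_sup_left
  have hker : G ⊓ levelStabilizer ⊤ (n + 1 + s) ≤ Γ :=
    sup_iterate_star_inf_levelStabilizer_le hself hs (n + 1)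
  have hker' : G ⊓ (levelAction (n + 1 + s)).ker ≤ Γ := by rwa [ker_levelAction]
  have hGs : G ≤ sylowProP σ :=
    sup_le hsylow ((iterate_star_mono hsylow _).trans (iterate_star_le (star_sylowProP_le σ) _))
  have hfin : Γ.relIndex G ≠ 0 := by
    rw [← Subgroup.relIndex_map_map_of_inf_ker_le (levelAction (n + 1 + s)) hΓG hker']
    exact Subgroup.index_ne_zero_of_finite
  have hidx : p ^ k ≤ Γ.relIndex G := by
    obtain ⟨f, hf, hsep⟩ := exists_separated_family hself hstar n
    have := Subgroup.card_le_relIndex hfin f (fun i => le_sup_right (a := Γ) (hf i)) hsep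
    rw [Nat.card_fun, Nat.card_fin, Nat.card_eq_fintype_card, Fintype.card_bool] at this
    exact hn.trans this
  obtain ⟨D, hΓD, hDG, hD⟩ := Subgroup.exists_relIndex_eq_prime_pow (levelAction (n + 1 + s)) hp
    hΓG hker' (isPGroup_map_levelAction hσ hGs _) hidx
  refine ⟨D, hΓD, hD, fun hle => ?_, (inf_le_inf_right _ hDG).trans hker⟩
  have hDΓ : D ≤ Γ := by
    intro g hg
    obtain ⟨γ, hγ, l, hl, rfl⟩ := exists_mul_of_mem_sup_iterate_star hself (hDG hg)
    exact Γ.mul_mem hγ (hle ⟨(Subgroup.mul_mem_cancel_left _ (hΓD hγ)).1 hg,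
      iterate_star_le_levelStabilizer Γ _ hl⟩)
  rw [Subgroup.relIndex_eq_one.2 hDΓ] at hD
  exact (Nat.one_lt_pow (by omega) hp.one_lt).ne hD

end RootedTree

/-! ### Countably many commensurable subgroups -/

namespace Subgroup

variable {A : Type*} [Group A]

lemma FG.of_relIndex_ne_zero {H D : Subgroup A} (hD : D.FG) (hHD : H ≤ D)
    (h : H.relIndex D ≠ 0) : H.FG := by
  have : Group.FG D := (Group.fg_iff_subgroup_fg D).2 hD
  have : (H.subgroupOf D).FiniteIndex := ⟨h⟩
  have : Group.FG (H.subgroupOf D) := fg_of_index_ne_zero _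
  exact (Group.fg_iff_subgroup_fg H).1
    (Group.fg_of_surjective (f := (subgroupOfEquivOfLe hHD).toMonoidHom)
      (subgroupOfEquivOfLe hHD).surjective)

lemma FG.of_finite_relIndex_le {H D : Subgroup A} (hH : H.FG) (hHD : H ≤ D)
    (h : H.relIndex D ≠ 0) : D.FG := by
  have : (H.subgroupOf D).FiniteIndex := ⟨h⟩
  have : Finite (D ⧸ H.subgroupOf D) := inferInstance
  let S : Set A := Set.range fun q : D ⧸ H.subgroupOf D => (q.out : A)
  have hS : (closure S).FG := (fg_iff _).2 ⟨S, rfl, Set.finite_range _⟩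
  have hD : H ⊔ closure S = D := by
    refine le_antisymm (sup_le hHD ((closure_le _).2 ?_)) fun d hd => ?_
    · rintro _ ⟨q, rfl⟩
      exact q.out.2
    · let q : D ⧸ H.subgroupOf D := QuotientGroup.mk ⟨d, hd⟩
      have h1 : (q.out : A)⁻¹ * d ∈ H :=
        (QuotientGroup.eq (b := (⟨d, hd⟩ : D))).1 (QuotientGroup.out_eq' q)
      rw [← mul_inv_cancel_left (q.out : A) d]
      exact mul_mem (mem_sup_right (subset_closure ⟨q, rfl⟩)) (mem_sup_left h1)
  rw [← hD]
  exact hH.sup hS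

lemma FG.countable {H : Subgroup A} (hH : H.FG) : Countable H := by
  have : Group.FG H := (Group.fg_iff_subgroup_fg H).2 hH
  obtain ⟨α, hα, φ, hφ⟩ := Group.fg_iff_exists_freeGroup_hom_surjective_finite.1 this
  have : Countable (FreeGroup α) := Quot.mk_surjective.countable
  exact hφ.countable

/-- If `Γ` is finitely generated and its subgroups of finite index have trivial centralizer in
`A`, then only countably many subgroups of `A` are commensurable with `Γ`. Indeed, an element of
such a subgroup conjugates some finite-index subgroup of `Γ` into `Γ` and is determined by the
images of finitely many generators, so the commensurator of `Γ` is countable; and the subgroups in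
question are finitely generated subgroups of the commensurator. -/
lemma countable_commensurable {Γ : Subgroup A} (hfg : Γ.FG)
    (hcent : ∀ H ≤ Γ, H.relIndex Γ ≠ 0 → ∀ c : A, (∀ h ∈ H, c * h = h * c) → c = 1) :
    {D : Subgroup A | (Γ ⊓ D).relIndex Γ ≠ 0 ∧ (Γ ⊓ D).relIndex D ≠ 0}.Countable := by
  have hΓ : Countable Γ := hfg.countable
  let I := {S : Finset Γ // (closure (((↑) : Γ → A) '' (S : Set Γ))).relIndex Γ ≠ 0}
  let C : I → Set A := fun S => {g | ∀ h ∈ S.1, g * (h : A) * g⁻¹ ∈ Γ}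
  have hC : ∀ S, (C S).Countable := by
    intro S
    let f : C S → (S.1 → Γ) := fun g h => ⟨g.1 * h.1 * g.1⁻¹, g.2 h.1 h.2⟩
    have hf : Function.Injective f := by
      intro g g' hgg
      have hle : closure (((↑) : Γ → A) '' (S.1 : Set Γ)) ≤ Γ := by
        rw [closure_le]
        rintro _ ⟨h, -, rfl⟩
        exact h.2
      have h1 : g'.1⁻¹ * g.1 = 1 := by
        refine hcent _ hle S.2 _ ?_
        have : closure (((↑) : Γ → A) '' (S.1 : Set Γ)) ≤ centralizer {g'.1⁻¹ * g.1} := by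
          rw [closure_le]
          rintro _ ⟨h, hh, rfl⟩
          have h2 : g.1 * (h : A) * g.1⁻¹ = g'.1 * h * g'.1⁻¹ :=
            congrArg Subtype.val (congrFun hgg ⟨h, hh⟩)
          rw [SetLike.mem_coe, mem_centralizer_singleton_iff]
          calc (h : A) * (g'.1⁻¹ * g.1) = g'.1⁻¹ * (g'.1 * h * g'.1⁻¹) * g.1 := by group
            _ = g'.1⁻¹ * g.1 * h := by rw [← h2]; group
        intro h hh
        exact (mem_centralizer_singleton_iff.1 (this hh)).symm
      exact Subtype.ext (inv_mul_eq_one.1 h1).symm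
    exact Set.countable_coe_iff.1 hf.countable
  let U : Set A := ⋃ S, C S
  have hU : Countable U := Set.countable_coe_iff.2 (Set.countable_iUnion hC)
  refine (Set.countable_range fun T : Finset U => closure (((↑) : U → A) '' (T : Set U))).mono ?_
  rintro D ⟨hD1, hD2⟩
  have hDU : ∀ d ∈ D, d ∈ U := by
    intro d hd
    have hmap : D.map (MulAut.conj d).toMonoidHom = D := by
      ext g
      constructor
      · rintro ⟨g, hg, rfl⟩
        exact D.mul_mem (D.mul_mem hd hg) (D.inv_mem hd)
      · intro hg
        refine ⟨d⁻¹ * g * d, D.mul_mem (D.mul_mem (D.inv_mem hd) hg) hd, ?_⟩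
        change d * (d⁻¹ * g * d) * d⁻¹ = g
        group
    -- the part of `Γ ⊓ D` that conjugation by `d` maps into `Γ ⊓ D`
    let H := (Γ ⊓ D) ⊓ (Γ ⊓ D).comap (MulAut.conj d).toMonoidHom
    have hH1 : H.relIndex D ≠ 0 := by
      refine relIndex_inf_ne_zero hD2 ?_
      rwa [relIndex_comap, hmap]
    have hH2 : H.relIndex Γ ≠ 0 := by
      refine relIndex_ne_zero_trans (K := Γ ⊓ D) (fun h0 => hH1 ?_) hD1
      rw [← relIndex_mul_relIndex H (Γ ⊓ D) D inf_le_left inf_le_right, h0, zero_mul]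
    have hHΓ : H ≤ Γ := inf_le_left.trans inf_le_left
    have hHfg : H.FG := hfg.of_relIndex_ne_zero hHΓ hH2
    obtain ⟨S, hS, hSfin⟩ := (fg_iff _).1 hHfg
    have hSH : S ⊆ H := hS ▸ subset_closure
    lift S to Finset A using hSfin
    classical
    have himg : ((↑) : Γ → A) '' ((S.subtype (· ∈ Γ) : Finset Γ) : Set Γ) = (S : Set A) := by
      ext a
      constructor
      · rintro ⟨h, hh, rfl⟩
        exact Finset.mem_subtype.1 hh
      · exact fun ha => ⟨⟨a, hHΓ (hSH ha)⟩, Finset.mem_subtype.2 ha, rfl⟩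
    refine Set.mem_iUnion.2 ⟨⟨S.subtype (· ∈ Γ), ?_⟩, fun h hh => ?_⟩
    · rw [himg, hS]
      exact hH2
    · exact (hSH (Finset.mem_subtype.1 hh)).2.1
  have hDfg : D.FG :=
    FG.of_finite_relIndex_le (hfg.of_relIndex_ne_zero inf_le_left hD1) inf_le_right hD2
  obtain ⟨T, hT⟩ := hDfg
  classical
  refine ⟨T.subtype (· ∈ U), ?_⟩
  have hTU : ∀ t ∈ T, t ∈ U := fun t ht => hDU t (hT ▸ subset_closure ht)
  have himg : ((↑) : U → A) '' ((T.subtype (· ∈ U) : Finset U) : Set U) = (T : Set A) := by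
    ext a
    constructor
    · rintro ⟨h, hh, rfl⟩
      exact Finset.mem_subtype.1 hh
    · exact fun ha => ⟨⟨a, hTU a ha⟩, Finset.mem_subtype.2 ha, rfl⟩
  change closure _ = D
  rw [himg, hT]

end Subgroup

namespace RootedTree

variable {X : Type*}

lemma infinite_of_isLevelTransitive [Finite X] [Nontrivial X] {G : Subgroup (TreeAut X)}
    (h : IsLevelTransitive G) : Infinite G := by
  by_contra hfin
  rw [not_infinite_iff_finite] at hfin
  have := Fintype.ofFinite X
  let n := Nat.card G
  obtain ⟨x⟩ : Nonempty X := inferInstance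
  let f : G → List.Vector X n := fun g => levelAction n g.1 (List.Vector.replicate n x)
  have hf : Function.Surjective f := by
    intro w
    obtain ⟨g, hg, hgw⟩ := h (List.replicate n x) w.1 (by rw [List.length_replicate, w.2])
    exact ⟨⟨g, hg⟩, Subtype.ext hgw⟩
  have h1 := Nat.card_le_card_of_surjective f hf
  rw [Nat.card_eq_fintype_card, card_vector] at h1
  exact absurd h1 (not_le.2 (Nat.lt_pow_self Fintype.one_lt_card))

/-- Finite-index subgroups of a regular branch group have trivial centralizer: they contain
nontrivial elements supported below any given vertex `v`, and an element commuting with one of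
these fixes `v`. -/
lemma eq_one_of_commute [Finite X] [Nontrivial X] {G : Subgroup (TreeAut X)}
    (hbranch : IsRegularBranch G) {H : Subgroup (TreeAut X)}
    (hH : H.relIndex G ≠ 0) {c : TreeAut X} (hc : ∀ h ∈ H, c * h = h * c) : c = 1 := by
  obtain ⟨htrans, K, hKG, hKfin, hKstar, -⟩ := hbranch
  have hKinf : Infinite K := by
    by_contra hfin
    rw [not_infinite_iff_finite] at hfin
    have h1 := Subgroup.card_mul_relIndex hKG
    have := infinite_of_isLevelTransitive htrans
    rw [Nat.card_eq_zero_of_infinite (α := G)] at h1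
    exact (mul_ne_zero Nat.card_pos.ne' hKfin.relIndex_ne_zero) h1
  refine ext_apply fun v => ?_
  obtain ⟨k, hkH, hk⟩ : ∃ k, graft v k ∈ H ∧ k ≠ 1 := by
    by_contra! hall
    have hbot : H.comap (graft v) = ⊥ := (Subgroup.eq_bot_iff_forall _).2 hall
    have hle : K.map (graft v) ≤ G := by
      rintro _ ⟨k, hk, rfl⟩
      exact hKG (graft_mem_of_star_le hKstar hk v)
    have h1 : H.relIndex (K.map (graft v)) ≠ 0 := fun h0 =>
      hH (Subgroup.relIndex_eq_zero_of_le_right hle h0)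
    rw [← Subgroup.relIndex_comap, hbot, Subgroup.relIndex_bot_left,
      Nat.card_eq_zero_of_infinite] at h1
    exact h1 rfl
  obtain ⟨w, hw⟩ : ∃ w, k.1 w ≠ w := by
    by_contra! hall
    exact hk (ext_apply hall)
  have hmove : (graft v k).1 (c.1 (v ++ w)) ≠ c.1 (v ++ w) := by
    rw [← mul_apply, ← hc _ hkH, mul_apply, graft_apply_append]
    exact fun h => hw (List.append_cancel_left (c.1.injective h))
  have hpre : v <+: c.1 (v ++ w) := by
    by_contra hpre
    exact hmove (graft_apply_of_not_prefix hpre k)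
  rw [sect_spec] at hpre
  exact ((List.prefix_of_prefix_length_le hpre (List.prefix_append _ _)
    (length_map c v).ge).eq_of_length (length_map c v).symm).symm

end RootedTree

theorem mainTheorem1 {X : Type*} (p : ℕ) (hp : p.Prime) (hX : Nat.card X = p)
    (σ : Equiv.Perm X) (hσ : σ.IsCycle) (hσp : orderOf σ = p)
    (Γ : Subgroup (RootedTree.TreeAut X))
    (hfg : Γ.FG)
    (hself : RootedTree.IsSelfSimilar Γ)
    (hbranch : RootedTree.IsRegularBranch Γ)
    (hsylow : Γ ≤ RootedTree.sylowProP σ)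
    (hrcsp : RootedTree.HasRigidCSP Γ)
    (k : ℕ) (hk : 1 ≤ k) :
    commensurabilityGrowth Γ (p ^ k) = Cardinal.aleph0 := by
  have hfinX : Finite X := Nat.finite_of_card_ne_zero (hX ▸ hp.ne_zero)
  have : Fintype X := Fintype.ofFinite X
  have hntX : Nontrivial X := Finite.one_lt_card_iff_nontrivial.1 (hX ▸ hp.one_lt)
  have hσ1 : σ ^ p = 1 := hσp ▸ pow_orderOf_eq_one σ
  have hcount : Countable {D // commensurabilityIndex Γ D = p ^ k} := by
    refine Set.countable_coe_iff.2 ((Subgroup.countable_commensurable hfg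
      fun H _ hH c => RootedTree.eq_one_of_commute hbranch hH).mono fun D hD => ?_)
    exact mul_ne_zero_iff.1 (ne_of_eq_of_ne hD (pow_pos hp.pos k).ne')
  have hinf : Infinite {D // commensurabilityIndex Γ D = p ^ k} := by
    have hstar := RootedTree.not_star_le hfg hself hbranch.1 hsylow
    obtain ⟨s, hs⟩ := RootedTree.exists_levelStabilizer_le_graftCore hself hbranch hrcsp
    -- consecutive levels differ by more than `s`, so that the overgroups below are distinct
    have hn : ∀ i : ℕ, p ^ k ≤ 2 ^ (p ^ k + i * (s + 1)) := fun i =>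
      Nat.lt_two_pow_self.le.trans (Nat.pow_le_pow_right two_pos (Nat.le_add_right _ _))
    choose D hΓD hD hdeep hshallow using fun i =>
      RootedTree.exists_overgroup hp hσ1 hself hsylow hstar hs hk (hn i)
    have hne : ∀ i j, i < j → D i ≠ D j := by
      intro i j hij h
      refine hdeep j (h ▸ (inf_le_inf_left (D i) (RootedTree.levelStabilizer_anti ⊤ ?_)).trans
        (hshallow i))
      have := Nat.mul_le_mul_right (s + 1) hij
      rw [Nat.succ_mul] at this
      omega
    refine Infinite.of_injective (fun i => (⟨D i, ?_⟩ :
      {D // commensurabilityIndex Γ D = p ^ k})) fun i j hij => ?_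
    · rw [commensurabilityIndex, inf_eq_left.2 (hΓD i), Subgroup.relIndex_self, one_mul, hD]
    · have h := congrArg Subtype.val hij
      rcases lt_trichotomy i j with hlt | heq | hgt
      · exact absurd h (hne i j hlt)
      · exact heq
      · exact absurd h.symm (hne j i hgt)
  exact Cardinal.mk_eq_aleph0 _
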